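/- Let $\{x\}=x-\lfloor x\rfloor$, let $\mathbb T=[0,1)$ be the unit circle (with $1$ identified with $0$), and let $\|x\|=\min\{x,1-x\}$ for $x\in\mathbb T$. Let $0<\alpha<1/2$ be irrational. For $\xi\in(\alpha,1-\alpha)$ and $\rho'\in\mathbb T$, let $J_1$ be the half-open arc of $\mathbb T$ from $1-\alpha$ to $1$, let $J_2$ be the half-open arc from $\xi-\alpha$ to $\xi$ (counter-clockwise), and let $J_0=\mathbb T\setminus(J_1\cup J_2)$. The ternary rotation coding $t_{\alpha,\xi,\rho'}\in\{0,1,2\}^{\mathbb N}$ is the infinite word whose $n$-th letter ($n\ge 0$) is the $i$ with $\{\rho'+n\alpha\}\in J_i$. The endpoint conventions of $J_1$ and of $J_2$ are chosen independently: $\overline{\alpha}$ means $J_1=(1-\alpha,1]$ and $\underline{\alpha}$ means $J_1=[1-\alpha,1)$; $\overline{\xi}$ means $J_2=(\xi-\alpha,\xi]$ and $\underline{\xi}$ means $J_2=[\xi-\alpha,\xi)$. Without bars, any of the four conventions is allowed. For an infinite word $x$, let $\mathcal L(x)$ be its set of finite factors, let $\overline{\mathcal O}(x)=\{y:\mathcal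 L(y)\subseteq\mathcal L(x)\}$ be its shift orbit closure, and let $\mathcal A(x)$ be its abelian closure, the set of infinite words $y$ such that each factor of $y$ is abelian equivalent to (contains each letter equally often as) some factor of $x$. **Proposition.** Let $u=t_{\alpha,\zeta,\rho}$, with any endpoint conventions, where $\zeta,\rho\in\mathbb T$ and $\|\zeta\|>\|\alpha\|$. Then $$\mathcal A(u)=\Bigl(\ \bigcup_{\substack{\xi,\rho'\in\mathbb T\\ \|\xi\|\ge\|\zeta\|}}\overline{\mathcal O}(t_{\alpha,\xi,\rho'})\Bigr)\setminus S,$$ where the union is also over all four endpoint conventions, and $S$ is a countable set of words, given as follows. 1. If neither $1-\|\zeta\|$ nor $\|\zeta\|$ is of the form $\{-m\alpha\}$ with $m\in\mathbb N$, then $S=\emptyset$. 2. Assume that $1-\|\zeta\|=\{-m\alpha\}$ for some $m\ge1$, and put $$H_m=\{t_{\overline{\alpha},\underline{\{m\alpha\}},\{-n\alpha\}}: n\ge0\}\cup\{t_{\underline{\alpha},\overline{\{-m\alpha\}},\{-(m+n)\alpha\}}: n\ge0\}.$$ If $u\in H_m$, then $S=\emptyset$; otherwise $S=H_m$. 3.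 Assume that $\|\zeta\|=\{-m\alpha\}$ for some $m\ge1$, and put $$L_m=\{t_{\overline{\alpha},\underline{\{-m\alpha\}},\{-(m+n)\alpha\}}: n\ge0\}\cup\{t_{\underline{\alpha},\overline{\{m\alpha\}},\{-n\alpha\}}: n\ge0\}.$$ If $u\in L_m$, then $S=\emptyset$; otherwise $S=L_m$. -/

import Mathlib

/-- Which endpoint a half-open arc of the circle contains: `left` (starting point; written with an
underline) or `right` (end point; written with an overline). -/
inductive Endpoint where
  | left
  | right

/-- The half-open arc of the circle `ℝ/ℤ` which runs counter-clockwise from `x` to `y`, for `x ≠ y`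
modulo `1`, as a `1`-periodic set of real numbers: `[x, y)` for `left` and `(x, y]` for `right`. -/
def arc : Endpoint → ℝ → ℝ → Set ℝ
  | Endpoint.left, x, y => {z | Int.fract (z - x) < Int.fract (y - x)}
  | Endpoint.right, x, y => {z | Int.fract (y - z) < Int.fract (y - x)}

/-- The distance to `0` on the circle: `min {x, 1 - x}` for `x ∈ [0, 1)`. -/
noncomputable def circleNorm (x : ℝ) : ℝ := min (Int.fract x) (1 - Int.fract x)

open scoped Classical in
/-- The ternary coding of rotation `t_{α,ζ,ρ}`, with slope `α`, offset `ζ` and intercept `ρ`.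
Its `n`-th letter is the code of the point `{ρ + nα}`: `1` on `J₁`, the arc from `1 - α` to `1`,
`2` on `J₂`, the arc from `ζ - α` to `ζ`, and `0` elsewhere. The endpoint conventions are `a` for
`J₁` and `b` for `J₂`. The arcs are disjoint for all `a`, `b` when `α < ζ < 1 - α`. -/
noncomputable def ternaryCoding (a b : Endpoint) (α ζ ρ : ℝ) : ℕ → Fin 3 := fun n =>
  if Int.fract (ρ + n * α) ∈ arc a (1 - α) 1 then 1
  else if Int.fract (ρ + n * α) ∈ arc b (ζ - α) ζ then 2
  else 0

/-- The block of `n` consecutive letters of `x` which starts at position `i`. -/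
def factorAt {A : Type*} (x : ℕ → A) (i n : ℕ) : List A := (List.range n).map fun j => x (i + j)

/-- The set of factors of an infinite word. -/
def language {A : Type*} (x : ℕ → A) : Set (List A) := {w | ∃ i n : ℕ, w = factorAt x i n}

/-- Abelian equivalence: each letter occurs equally often in `u` and in `v`. -/
def AbelianEquiv {A : Type*} [DecidableEq A] (u v : List A) : Prop :=
  ∀ c : A, u.count c = v.count c

/-- The abelian closure of an infinite word. -/
def abelianClosure {A : Type*} [DecidableEq A] (x : ℕ → A) : Set (ℕ → A) :=
  {y | ∀ u ∈ language y, ∃ v ∈ language x, AbelianEquiv u v}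

/-- The shift orbit closure of an infinite word. -/
def orbitClosure {A : Type*} (x : ℕ → A) : Set (ℕ → A) := {y | language y ⊆ language x}

/-- The words `t_{α,ξ,ρ'}` with overlined `α`, underlined `ξ = {mα}`, `ρ' = {-nα}`, and those with
underlined `α`, overlined `ξ = {-mα}`, `ρ' = {-(m+n)α}`, for `n ≥ 0`. -/
def heavyExceptions (α : ℝ) (m : ℕ) : Set (ℕ → Fin 3) :=
  {w | ∃ n : ℕ, w = ternaryCoding Endpoint.right Endpoint.left α
      (Int.fract (m * α)) (Int.fract (-(n * α)))} ∪
  {w | ∃ n : ℕ, w = ternaryCoding Endpoint.left Endpoint.right α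
      (Int.fract (-(m * α))) (Int.fract (-((m + n) * α)))}

/-- The words `t_{α,ξ,ρ'}` with overlined `α`, underlined `ξ = {-mα}`, `ρ' = {-(m+n)α}`, and those
with underlined `α`, overlined `ξ = {mα}`, `ρ' = {-nα}`, for `n ≥ 0`. -/
def lightExceptions (α : ℝ) (m : ℕ) : Set (ℕ → Fin 3) :=
  {w | ∃ n : ℕ, w = ternaryCoding Endpoint.right Endpoint.left α
      (Int.fract (-(m * α))) (Int.fract (-((m + n) * α)))} ∪
  {w | ∃ n : ℕ, w = ternaryCoding Endpoint.left Endpoint.right α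
      (Int.fract (m * α)) (Int.fract (-(n * α)))}

/-! Each of the letters 1 and 2 of a coding marks the visits of an irrational rotation to an arc of
length α, so its number in a factor of length n is ⌊nα⌋ or ⌊nα⌋ + 1. It is the larger one exactly
when the starting point lies in an arc of length {nα} ending at 0 (letter 1) or at ξ (letter 2).
Conversely, counts of this kind force a letter to code a rotation by α (`exists_codesLetter`), so
every word of the abelian closure is again a coding of two arcs, with some offset ξ.

For a fixed n > 0 the excesses over ⌊nα⌋ form a pair in {0,1}². The pairs (1,0) and (0,1) always
occur. Hence the abelian closure only depends on the lengths n for which (1,1) ("heavy") or (0,0)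
("light") occurs (`CodesPair.mem_abelianClosure_iff`). The pair (1,1) means that the orbit meets the
intersection of two arcs of length {nα}. By density this happens if ‖ξ‖ < {nα}, and it cannot happen
if ‖ξ‖ > {nα}, which yields ‖ξ‖ ≥ ‖ζ‖. If ‖ξ‖ = {nα}, the arcs share at most an endpoint: the
endpoint conventions must be right and the orbit must hit that very point. Such words are the heavy
exceptions. The light ones arise in the same way from the complementary arcs, of length 1 - {nα}. -/

/-! ### Visits to half-open arcs as increments of floor and ceiling. -/

/-- The function whose increments count the visits to a half-open arc: the floor for arcs
`[x, y)`, the ceiling for arcs `(x, y]`. -/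
noncomputable def endRound : Endpoint → ℝ → ℤ
  | Endpoint.left, x => ⌊x⌋
  | Endpoint.right, x => ⌈x⌉

lemma endRound_add_int (e : Endpoint) (x : ℝ) (k : ℤ) :
    endRound e (x + k) = endRound e x + k := by
  cases e <;> simp [endRound]

/-- The increment of `endRound` over a step `δ`. -/
noncomputable def roundStep (e : Endpoint) (δ x : ℝ) : ℤ := endRound e (x + δ) - endRound e x

lemma roundStep_add_int (e : Endpoint) (δ x : ℝ) (k : ℤ) :
    roundStep e δ (x + k) = roundStep e δ x := by
  unfold roundStep
  rw [show x + k + δ = x + δ + k by ring, endRound_add_int, endRound_add_int]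
  ring

lemma roundStep_fract_left (e : Endpoint) (t x : ℝ) :
    roundStep e (Int.fract t) x + ⌊t⌋ = roundStep e t x := by
  unfold roundStep
  conv_rhs => rw [← Int.fract_add_floor t, ← add_assoc, endRound_add_int]
  ring

lemma roundStep_fract (e : Endpoint) (δ x : ℝ) :
    roundStep e δ (Int.fract x) = roundStep e δ x := by
  conv_rhs => rw [← Int.fract_add_floor x, roundStep_add_int]

/-- The step from r to r + δ is counted on the arc from 1 - δ to 1. The endpoint convention matters
only at r = 0 and r = 1 - δ, which are therefore listed separately. -/
lemma roundStep_eq_of_fract {e : Endpoint} {δ r : ℝ} (hδ0 : 0 < δ) (hδ1 : δ < 1) (hr0 : 0 ≤ r)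
    (hr1 : r < 1) :
    (roundStep e δ r = 1 ∧ (1 - δ < r ∨ (e = Endpoint.left ∧ r = 1 - δ) ∨
        (e = Endpoint.right ∧ r = 0))) ∨
      (roundStep e δ r = 0 ∧ ((0 < r ∧ r < 1 - δ) ∨ (e = Endpoint.right ∧ r = 1 - δ) ∨
        (e = Endpoint.left ∧ r = 0))) := by
  cases e
  · have h0 : ⌊r⌋ = 0 := Int.floor_eq_iff.2 (by constructor <;> push_cast <;> linarith)
    by_cases h : 1 - δ ≤ r
    · left
      have h1 : ⌊r + δ⌋ = 1 := Int.floor_eq_iff.2 (by constructor <;> push_cast <;> linarith)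
      refine ⟨by simp [roundStep, endRound, h0, h1], ?_⟩
      rcases h.lt_or_eq with h | h
      · exact Or.inl h
      · exact Or.inr (Or.inl ⟨rfl, h.symm⟩)
    · right
      push Not at h
      have h1 : ⌊r + δ⌋ = 0 := Int.floor_eq_iff.2 (by constructor <;> push_cast <;> linarith)
      refine ⟨by simp [roundStep, endRound, h0, h1], ?_⟩
      rcases hr0.lt_or_eq with h' | h'
      · exact Or.inl ⟨h', h⟩
      · exact Or.inr (Or.inr ⟨rfl, h'.symm⟩)
  · rcases hr0.lt_or_eq with h' | h'
    · have h0 : ⌈r⌉ = 1 := Int.ceil_eq_iff.2 (by constructor <;> push_cast <;> linarith)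
      by_cases h : 1 - δ < r
      · left
        have h1 : ⌈r + δ⌉ = 2 := Int.ceil_eq_iff.2 (by constructor <;> push_cast <;> linarith)
        exact ⟨by simp [roundStep, endRound, h0, h1], Or.inl h⟩
      · right
        push Not at h
        have h1 : ⌈r + δ⌉ = 1 := Int.ceil_eq_iff.2 (by constructor <;> push_cast <;> linarith)
        refine ⟨by simp [roundStep, endRound, h0, h1], ?_⟩
        rcases h.lt_or_eq with h | h
        · exact Or.inl ⟨h', h⟩
        · exact Or.inr (Or.inl ⟨rfl, h⟩)
    · left
      subst h'
      have h1 : ⌈δ⌉ = 1 := Int.ceil_eq_iff.2 (by constructor <;> push_cast <;> linarith)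
      exact ⟨by simp [roundStep, endRound, h1], Or.inr (Or.inr ⟨rfl, rfl⟩)⟩

lemma roundStep_eq_one_or_zero (e : Endpoint) {δ : ℝ} (x : ℝ) (hδ0 : 0 < δ) (hδ1 : δ < 1) :
    roundStep e δ x = 1 ∨ roundStep e δ x = 0 := by
  rw [← roundStep_fract]
  rcases roundStep_eq_of_fract (e := e) hδ0 hδ1 (Int.fract_nonneg x) (Int.fract_lt_one x) with h | h
  exacts [Or.inl h.1, Or.inr h.1]

lemma roundStep_eq_one {e : Endpoint} {δ r : ℝ} (hδ1 : δ < 1)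
    (h : 1 - δ < r) (hr1 : r < 1) : roundStep e δ r = 1 := by
  rcases roundStep_eq_of_fract (e := e) (δ := δ) (r := r) (by linarith) hδ1 (by linarith) hr1
    with h' | h'
  · exact h'.1
  · rcases h'.2 with h' | h' | h' <;> linarith [h'.2]

lemma roundStep_eq_zero {e : Endpoint} {δ r : ℝ} (hδ0 : 0 < δ)
    (h : 0 < r) (hr1 : r < 1 - δ) : roundStep e δ r = 0 := by
  rcases roundStep_eq_of_fract (e := e) (δ := δ) (r := r) hδ0 (by linarith) h.le (by linarith)
    with h' | h'
  · rcases h'.2 with h' | h' | h'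
    · linarith
    · linarith [h'.2]
    · linarith [h'.2]
  · exact h'.1

lemma mem_arc_iff (e : Endpoint) {α : ℝ} (hα0 : 0 < α) (hα1 : α < 1) (c x : ℝ) :
    Int.fract x ∈ arc e (c - α) c ↔ roundStep e α (x - c) = 1 := by
  have hα : Int.fract α = α := Int.fract_eq_self.2 ⟨hα0.le, hα1⟩
  rw [show roundStep e α (x - c) = roundStep e α (Int.fract x - c) by
    conv_lhs => rw [← Int.fract_add_floor x]
    rw [show Int.fract x + ⌊x⌋ - c = Int.fract x - c + ⌊x⌋ by ring, roundStep_add_int]]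
  generalize Int.fract x = z
  rw [← roundStep_fract]
  have key := roundStep_eq_of_fract (e := e) hα0 hα1 (Int.fract_nonneg (z - c))
    (Int.fract_lt_one (z - c))
  set r := Int.fract (z - c) with hr
  have hr0 : 0 ≤ r := Int.fract_nonneg _
  have hr1 : r < 1 := Int.fract_lt_one _
  have hzr : z - c = r + ⌊z - c⌋ := (Int.fract_add_floor _).symm
  cases e
  · simp only [arc, Set.mem_ofPred_eq, sub_sub_cancel, hα]
    have h1 : Int.fract (z - (c - α)) = Int.fract (r + α) := by
      rw [show z - (c - α) = r + α + ⌊z - c⌋ by linarith, Int.fract_add_intCast]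
    rw [h1]
    by_cases h : 1 - α ≤ r
    · have : Int.fract (r + α) = r + α - 1 := by
        rw [← Int.fract_sub_one]; exact Int.fract_eq_self.2 ⟨by linarith, by linarith⟩
      rw [this]
      refine ⟨fun _ => ?_, fun _ => by linarith⟩
      rcases key with h' | h'
      · exact h'.1
      · rcases h'.2 with h' | h' | h'
        · linarith [h'.2]
        · exact absurd h'.1 (by simp)
        · linarith [h'.2]
    · push Not at h
      have : Int.fract (r + α) = r + α := Int.fract_eq_self.2 ⟨by linarith, by linarith⟩
      rw [this]
      refine ⟨fun _ => by linarith, fun h2 => ?_⟩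
      rcases key with h' | h'
      · rcases h'.2 with h' | h' | h'
        · linarith
        · linarith [h'.2]
        · exact absurd h'.1 (by simp)
      · omega
  · simp only [arc, Set.mem_ofPred_eq, sub_sub_cancel, hα]
    have h1 : Int.fract (c - z) = Int.fract (-r) := by
      rw [show c - z = -r + ((-⌊z - c⌋ : ℤ) : ℝ) by push_cast; linarith, Int.fract_add_intCast]
    rw [h1]
    rcases hr0.lt_or_eq with h0 | h0
    · have : Int.fract (-r) = 1 - r := by
        rw [← Int.fract_add_one]
        rw [show -r + 1 = 1 - r by ring]
        exact Int.fract_eq_self.2 ⟨by linarith, by linarith⟩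
      rw [this]
      constructor
      · intro h2
        exact roundStep_eq_one hα1 (by linarith) hr1
      · intro h2
        rcases key with h' | h'
        · rcases h'.2 with h' | h' | h'
          · linarith
          · exact absurd h'.1 (by simp)
          · linarith [h'.2]
        · omega
    · rw [← h0] at key ⊢
      refine ⟨fun _ => ?_, fun _ => by simpa using hα0⟩
      rcases key with h' | h'
      · exact h'.1
      · rcases h'.2 with h' | h' | h'
        · linarith [h'.1]
        · linarith [h'.2]
        · exact absurd h'.1 (by simp)

/-! ### Intersections of two arcs of equal length. -/

/-- Splitting at ξ turns membership in the translated arc into linear inequalities in the fractional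
part of x. -/
lemma fract_sub_eq {ξ x : ℝ} (h0 : 0 ≤ ξ) (h1 : ξ < 1) :
    (ξ ≤ Int.fract x ∧ Int.fract (x - ξ) = Int.fract x - ξ) ∨
      (Int.fract x < ξ ∧ Int.fract (x - ξ) = Int.fract x - ξ + 1) := by
  have a0 := Int.fract_nonneg x
  have a1 := Int.fract_lt_one x
  rcases le_or_gt ξ (Int.fract x) with h | h
  · refine Or.inl ⟨h, ?_⟩
    rw [Int.fract_eq_iff]
    exact ⟨by linarith, by linarith, ⌊x⌋, by linarith [Int.fract_add_floor x]⟩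
  · refine Or.inr ⟨h, ?_⟩
    rw [Int.fract_eq_iff]
    exact ⟨by linarith, by linarith, ⌊x⌋ - 1, by push_cast; linarith [Int.fract_add_floor x]⟩

lemma circleNorm_of_mem {ξ : ℝ} (h0 : 0 ≤ ξ) (h1 : ξ < 1) : circleNorm ξ = min ξ (1 - ξ) := by
  rw [circleNorm, Int.fract_eq_self.2 ⟨h0, h1⟩]

/-- When the arcs of length `δ` ending at `0` and at `ξ` meet. -/
lemma roundStep_both_one {a b : Endpoint} {δ ξ x : ℝ} (hδ0 : 0 < δ) (hδ1 : δ < 1) (h0 : 0 ≤ ξ)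
    (h1 : ξ < 1) (ha : roundStep a δ x = 1) (hb : roundStep b δ (x - ξ) = 1) :
    circleNorm ξ < δ ∨
      (a = Endpoint.right ∧ b = Endpoint.left ∧ ξ = δ ∧ Int.fract x = 0) ∨
      (a = Endpoint.left ∧ b = Endpoint.right ∧ ξ = 1 - δ ∧ Int.fract x = 1 - δ) := by
  rw [circleNorm_of_mem h0 h1, min_lt_iff]
  rw [← roundStep_fract] at ha hb
  have ka := roundStep_eq_of_fract (e := a) hδ0 hδ1 (Int.fract_nonneg x) (Int.fract_lt_one x)
  have kb := roundStep_eq_of_fract (e := b) hδ0 hδ1 (Int.fract_nonneg (x - ξ))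
    (Int.fract_lt_one (x - ξ))
  have b1 := Int.fract_lt_one x
  have b0 := Int.fract_nonneg x
  replace ka := (ka.resolve_right (by omega)).2
  replace kb := (kb.resolve_right (by omega)).2
  rcases fract_sub_eq (x := x) h0 h1 with ⟨h, e⟩ | ⟨h, e⟩ <;> rw [e] at kb <;>
    rcases ka with ka | ⟨ka, ka'⟩ | ⟨ka, ka'⟩ <;> rcases kb with kb | ⟨kb, kb'⟩ | ⟨kb, kb'⟩ <;>
    first
    | exact Or.inl (Or.inl (by linarith))
    | exact Or.inl (Or.inr (by linarith))
    | exact Or.inr (Or.inl ⟨ka, kb, by linarith, by linarith⟩)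
    | exact Or.inr (Or.inr ⟨ka, kb, by linarith, by linarith⟩)

/-- When the complements of the arcs of length `δ` ending at `0` and at `ξ` meet. -/
lemma roundStep_both_zero {a b : Endpoint} {δ ξ x : ℝ} (hδ0 : 0 < δ) (hδ1 : δ < 1) (h0 : 0 ≤ ξ)
    (h1 : ξ < 1) (ha : roundStep a δ x = 0) (hb : roundStep b δ (x - ξ) = 0) :
    circleNorm ξ < 1 - δ ∨
      (a = Endpoint.right ∧ b = Endpoint.left ∧ ξ = 1 - δ ∧ Int.fract x = 1 - δ) ∨
      (a = Endpoint.left ∧ b = Endpoint.right ∧ ξ = δ ∧ Int.fract x = 0) := by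
  rw [circleNorm_of_mem h0 h1, min_lt_iff]
  rw [← roundStep_fract] at ha hb
  have ka := roundStep_eq_of_fract (e := a) hδ0 hδ1 (Int.fract_nonneg x) (Int.fract_lt_one x)
  have kb := roundStep_eq_of_fract (e := b) hδ0 hδ1 (Int.fract_nonneg (x - ξ))
    (Int.fract_lt_one (x - ξ))
  have b1 := Int.fract_lt_one x
  have b0 := Int.fract_nonneg x
  replace ka := (ka.resolve_left (by omega)).2
  replace kb := (kb.resolve_left (by omega)).2
  rcases fract_sub_eq (x := x) h0 h1 with ⟨h, e⟩ | ⟨h, e⟩ <;> rw [e] at kb <;>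
    rcases ka with ka | ⟨ka, ka'⟩ | ⟨ka, ka'⟩ <;> rcases kb with kb | ⟨kb, kb'⟩ | ⟨kb, kb'⟩ <;>
    first
    | exact Or.inl (Or.inl (by linarith))
    | exact Or.inl (Or.inr (by linarith))
    | exact Or.inr (Or.inl ⟨ka, kb, by linarith, by linarith⟩)
    | exact Or.inr (Or.inr ⟨ka, kb, by linarith, by linarith⟩)

/-! ### Density of the orbit and the patterns it forces. -/

/-- The forward orbit of an irrational rotation visits every open arc. -/
lemma exists_nat_fract_mem_Ioo {α : ℝ} (hα : Irrational α) (ρ : ℝ) {p q : ℝ} (hp : 0 ≤ p)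
    (hpq : p < q) (hq : q ≤ 1) : ∃ i : ℕ, p < Int.fract (ρ + i * α) ∧ Int.fract (ρ + i * α) < q := by
  obtain ⟨n, hn⟩ := exists_nat_one_div_lt (sub_pos.2 hpq)
  obtain ⟨j, k, hk0, -, hk⟩ := Real.exists_int_int_abs_mul_sub_le α (Nat.succ_pos n)
  lift k to ℕ using hk0.le
  set d : ℝ := k * α - j with hd
  have hd0 : d ≠ 0 := by
    have : Irrational ((k : ℝ) * α - j) := (hα.natCast_mul (by omega)).sub_intCast j
    exact this.ne_zero
  have hdq : |d| < q - p := by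
    refine lt_of_le_of_lt ?_ hn
    have hk' : |d| ≤ 1 / ((n.succ : ℝ) + 1) := by exact_mod_cast hk
    refine hk'.trans (one_div_le_one_div_of_le (by positivity) ?_)
    push_cast
    linarith
  -- Every k-th point of the orbit moves by d modulo 1. Since |d| < q - p, this walk cannot jump
  -- over the interval. `N` makes it start on the correct side, and `t` is chosen as the first time
  -- it crosses the nearer end.
  suffices ∃ (t : ℕ) (N : ℤ), p < ρ + t * d - N ∧ ρ + t * d - N < q by
    obtain ⟨t, N, h1, h2⟩ := this
    have : Int.fract (ρ + (t * k : ℕ) * α) = ρ + t * d - N := by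
      rw [Int.fract_eq_iff]
      refine ⟨by linarith, by linarith, N + t * j, ?_⟩
      rw [hd]; push_cast; ring
    exact ⟨t * k, by rw [this]; exact h1, by rw [this]; exact h2⟩
  rcases lt_or_gt_of_ne hd0 with h | h
  · rw [abs_of_neg h] at hdq
    have e1 := Int.floor_le (ρ - q)
    set N := ⌊ρ - q⌋
    have e2 := Nat.floor_le (a := (ρ - N - q) / -d) (div_nonneg (by linarith) (by linarith))
    have e3 := Nat.lt_floor_add_one ((ρ - N - q) / -d)
    rw [le_div_iff₀ (by linarith)] at e2
    rw [div_lt_iff₀ (by linarith)] at e3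
    exact ⟨⌊(ρ - N - q) / -d⌋₊ + 1, N, by push_cast; linarith, by push_cast; linarith⟩
  · rw [abs_of_pos h] at hdq
    have e1 := Int.le_ceil (ρ - p)
    set N := ⌈ρ - p⌉
    have e2 := Nat.floor_le (a := (N + p - ρ) / d) (div_nonneg (by linarith) (by linarith))
    have e3 := Nat.lt_floor_add_one ((N + p - ρ) / d)
    rw [le_div_iff₀ (by linarith)] at e2
    rw [div_lt_iff₀ (by linarith)] at e3
    exact ⟨⌊(N + p - ρ) / d⌋₊ + 1, N, by push_cast; linarith, by push_cast; linarith⟩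

lemma exists_roundStep_one_one {α : ℝ} (hα : Irrational α) (a b : Endpoint) (ρ : ℝ) {δ ξ : ℝ}
    (hδ1 : δ < 1)
    (h0 : 0 ≤ ξ) (h1 : ξ < 1) (h : circleNorm ξ < δ) :
    ∃ i : ℕ, roundStep a δ (ρ + i * α) = 1 ∧ roundStep b δ (ρ + i * α - ξ) = 1 := by
  rw [circleNorm_of_mem h0 h1, min_lt_iff] at h
  rcases h with h | h
  -- For ξ < δ the arc ending at ξ, shifted by 1, runs from 1 + ξ - δ to 1 + ξ and overlaps the arc
  -- from 1 - δ to 1 in this interval.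
  · obtain ⟨i, hi1, hi2⟩ := exists_nat_fract_mem_Ioo hα ρ (p := 1 - δ + ξ) (q := 1)
      (by linarith) (by linarith) le_rfl
    refine ⟨i, ?_, ?_⟩ <;> rw [← roundStep_fract] <;>
      rcases fract_sub_eq (x := ρ + i * α) h0 h1 with ⟨h, e⟩ | ⟨h, e⟩ <;>
      try rw [e]
    all_goals apply roundStep_eq_one hδ1 <;> linarith
  · obtain ⟨i, hi1, hi2⟩ := exists_nat_fract_mem_Ioo hα ρ (p := 1 - δ) (q := ξ)
      (by linarith) (by linarith) h1.le
    refine ⟨i, ?_, ?_⟩ <;> rw [← roundStep_fract] <;>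
      rcases fract_sub_eq (x := ρ + i * α) h0 h1 with ⟨h, e⟩ | ⟨h, e⟩ <;>
      try rw [e]
    all_goals apply roundStep_eq_one hδ1 <;> linarith

lemma exists_roundStep_zero_zero {α : ℝ} (hα : Irrational α) (a b : Endpoint) (ρ : ℝ) {δ ξ : ℝ}
    (hδ0 : 0 < δ)
    (h0 : 0 ≤ ξ) (h1 : ξ < 1) (h : circleNorm ξ < 1 - δ) :
    ∃ i : ℕ, roundStep a δ (ρ + i * α) = 0 ∧ roundStep b δ (ρ + i * α - ξ) = 0 := by
  rw [circleNorm_of_mem h0 h1, min_lt_iff] at h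
  rcases h with h | h
  · obtain ⟨i, hi1, hi2⟩ := exists_nat_fract_mem_Ioo hα ρ (p := ξ) (q := 1 - δ)
      (by linarith) (by linarith) (by linarith)
    refine ⟨i, ?_, ?_⟩ <;> rw [← roundStep_fract] <;>
      rcases fract_sub_eq (x := ρ + i * α) h0 h1 with ⟨h, e⟩ | ⟨h, e⟩ <;>
      try rw [e]
    all_goals apply roundStep_eq_zero hδ0 <;> linarith
  · obtain ⟨i, hi1, hi2⟩ := exists_nat_fract_mem_Ioo hα ρ (p := 0) (q := ξ - δ)
      (by linarith) (by linarith) (by linarith)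
    refine ⟨i, ?_, ?_⟩ <;> rw [← roundStep_fract] <;>
      rcases fract_sub_eq (x := ρ + i * α) h0 h1 with ⟨h, e⟩ | ⟨h, e⟩ <;>
      try rw [e]
    all_goals apply roundStep_eq_zero hδ0 <;> linarith

/-- No bound on `circleNorm ξ` is needed: of two distinct arcs of equal length, neither contains the
other, and their difference has interior. -/
lemma exists_roundStep_one_zero {α : ℝ} (hα : Irrational α) (a b : Endpoint) (ρ : ℝ) {δ ξ : ℝ}
    (hδ0 : 0 < δ) (hδ1 : δ < 1) (h0 : 0 < ξ) (h1 : ξ < 1) :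
    ∃ i : ℕ, roundStep a δ (ρ + i * α) = 1 ∧ roundStep b δ (ρ + i * α - ξ) = 0 := by
  obtain ⟨i, hi1, hi2⟩ := exists_nat_fract_mem_Ioo hα ρ (p := max (1 - δ) ξ)
    (q := min 1 (1 - δ + ξ)) (le_max_of_le_right h0.le) (by
      rw [max_lt_iff, lt_min_iff, lt_min_iff]
      exact ⟨⟨by linarith, by linarith⟩, by linarith, by linarith⟩) (min_le_left _ _)
  rw [max_lt_iff] at hi1
  rw [lt_min_iff] at hi2
  obtain ⟨hi1, hi3⟩ := hi1
  obtain ⟨hi2, hi4⟩ := hi2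
  refine ⟨i, ?_, ?_⟩ <;> rw [← roundStep_fract]
  · apply roundStep_eq_one hδ1 <;> linarith
  · rcases fract_sub_eq (x := ρ + i * α) h0.le h1 with ⟨h, e⟩ | ⟨h, e⟩ <;> rw [e] <;>
      apply roundStep_eq_zero hδ0 <;> linarith

lemma exists_roundStep_zero_one {α : ℝ} (hα : Irrational α) (a b : Endpoint) (ρ : ℝ) {δ ξ : ℝ}
    (hδ0 : 0 < δ) (hδ1 : δ < 1) (h0 : 0 < ξ) (h1 : ξ < 1) :
    ∃ i : ℕ, roundStep a δ (ρ + i * α) = 0 ∧ roundStep b δ (ρ + i * α - ξ) = 1 := by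
  obtain ⟨i, hi1, hi2⟩ := exists_nat_fract_mem_Ioo hα ρ (p := max 0 (ξ - δ))
    (q := min (1 - δ) ξ) (le_max_left _ _) (by
      rw [max_lt_iff, lt_min_iff, lt_min_iff]
      exact ⟨⟨by linarith, by linarith⟩, by linarith, by linarith⟩)
    ((min_le_right _ _).trans h1.le)
  rw [max_lt_iff] at hi1
  rw [lt_min_iff] at hi2
  obtain ⟨hi1, hi3⟩ := hi1
  obtain ⟨hi2, hi4⟩ := hi2
  refine ⟨i, ?_, ?_⟩ <;> rw [← roundStep_fract]
  · apply roundStep_eq_zero hδ0 <;> linarith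
  · rcases fract_sub_eq (x := ρ + i * α) h0.le h1 with ⟨h, e⟩ | ⟨h, e⟩ <;> rw [e] <;>
      apply roundStep_eq_one hδ1 <;> linarith

/-! ### Factors, letter counts and abelian equivalence. -/

section Factors

variable {A : Type*}

lemma length_factorAt (x : ℕ → A) (i n : ℕ) : (factorAt x i n).length = n := by
  simp [factorAt]

lemma factorAt_succ (x : ℕ → A) (i n : ℕ) :
    factorAt x i (n + 1) = factorAt x i n ++ [x (i + n)] := by
  simp [factorAt, List.range_succ]

lemma count_factorAt_succ [DecidableEq A] (x : ℕ → A) (i n : ℕ) (c : A) :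
    (factorAt x i (n + 1)).count c = (factorAt x i n).count c + if x (i + n) = c then 1 else 0 := by
  rw [factorAt_succ, List.count_append, List.count_singleton]
  simp [beq_iff_eq]

lemma count_factorAt_one [DecidableEq A] (x : ℕ → A) (i : ℕ) (c : A) :
    (factorAt x i 1).count c = if x i = c then 1 else 0 := by
  rw [count_factorAt_succ]; simp [factorAt]

lemma count_factorAt_add [DecidableEq A] (x : ℕ → A) (i n : ℕ) (c : A) :
    (factorAt x 0 (i + n)).count c = (factorAt x 0 i).count c + (factorAt x i n).count c := by
  induction n with
  | zero => simp [factorAt]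
  | succ n ih => rw [← add_assoc, count_factorAt_succ, ih, count_factorAt_succ]; simp; ring

end Factors

lemma count_zero_add_count_one_add_count_two (l : List (Fin 3)) :
    l.count 0 + l.count 1 + l.count 2 = l.length := by
  induction l with
  | nil => rfl
  | cons c l ih =>
    simp only [List.count_cons, List.length_cons]
    fin_cases c <;> simp <;> omega

lemma abelianEquiv_iff (l l' : List (Fin 3)) :
    AbelianEquiv l l' ↔ l.length = l'.length ∧ l.count 1 = l'.count 1 ∧ l.count 2 = l'.count 2 := by
  have h := count_zero_add_count_one_add_count_two l
  have h' := count_zero_add_count_one_add_count_two l'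
  constructor
  · intro H
    have := H 0
    have := H 1
    have := H 2
    omega
  · rintro ⟨h1, h2, h3⟩ c
    fin_cases c
    · change l.count 0 = l'.count 0
      omega
    · exact h2
    · exact h3

lemma mem_abelianClosure_iff (x y : ℕ → Fin 3) :
    y ∈ abelianClosure x ↔ ∀ i n : ℕ, ∃ j : ℕ,
      (factorAt y i n).count 1 = (factorAt x j n).count 1 ∧
        (factorAt y i n).count 2 = (factorAt x j n).count 2 := by
  constructor
  · intro h i n
    obtain ⟨_, ⟨j, k, rfl⟩, hv⟩ := h _ ⟨i, n, rfl⟩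
    rw [abelianEquiv_iff, length_factorAt, length_factorAt] at hv
    obtain ⟨rfl, h1, h2⟩ := hv
    exact ⟨j, h1, h2⟩
  · rintro h _ ⟨i, n, rfl⟩
    obtain ⟨j, h1, h2⟩ := h i n
    refine ⟨_, ⟨j, n, rfl⟩, (abelianEquiv_iff _ _).2 ⟨?_, h1, h2⟩⟩
    rw [length_factorAt, length_factorAt]

lemma orbitClosure_subset_abelianClosure (x : ℕ → Fin 3) : orbitClosure x ⊆ abelianClosure x :=
  fun _ hy w hw => ⟨w, hy hw, fun _ => rfl⟩

/-! ### Letters that code a rotation. -/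

/-- The occurrences of the letter `c` in `y` are the visits of the orbit of `ρ` under the rotation
by `α` to the half-open arc of length `α` which ends at `0`. -/
def CodesLetter {A : Type*} [DecidableEq A] (α : ℝ) (e : Endpoint) (ρ : ℝ) (y : ℕ → A) (c : A) :
    Prop :=
  ∀ i n : ℕ, ((factorAt y i n).count c : ℤ) = roundStep e (n * α) (ρ + i * α)

lemma CodesLetter.count_eq {A : Type*} [DecidableEq A] {α : ℝ} {e : Endpoint} {ρ : ℝ} {y : ℕ → A}
    {c : A} (h : CodesLetter α e ρ y c) (i n : ℕ) :
    ((factorAt y i n).count c : ℤ) = roundStep e (Int.fract (n * α)) (ρ + i * α) + ⌊n * α⌋ := by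
  rw [h, roundStep_fract_left]

lemma CodesLetter.letter {A : Type*} [DecidableEq A] {α : ℝ} {e : Endpoint} {ρ : ℝ} {y : ℕ → A}
    {c : A} (h : CodesLetter α e ρ y c) (i : ℕ) :
    y i = c ↔ roundStep e α (ρ + i * α) = 1 := by
  have := h i 1
  rw [count_factorAt_one, Nat.cast_one, one_mul] at this
  rw [← this]
  split_ifs with h <;> simp [h]

/-- The increments of `endRound` telescope, so length 1 suffices. -/
lemma codesLetter_of_letter {A : Type*} [DecidableEq A] {α : ℝ} (hα0 : 0 < α) (hα1 : α < 1)
    {e : Endpoint} {ρ : ℝ} {y : ℕ → A} {c : A}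
    (h : ∀ i : ℕ, y i = c ↔ roundStep e α (ρ + i * α) = 1) : CodesLetter α e ρ y c := by
  intro i n
  induction n with
  | zero => simp [factorAt, roundStep]
  | succ n ih =>
    rw [count_factorAt_succ]
    push_cast
    rw [ih]
    have h1 : (if y (i + n) = c then 1 else 0 : ℤ) = roundStep e α (ρ + ((i + n : ℕ) : ℝ) * α) := by
      split_ifs with h2
      · rw [(h _).1 h2]
      · exact ((roundStep_eq_one_or_zero e _ hα0 hα1).resolve_left fun h3 => h2 ((h _).2 h3)).symm
    rw [h1]
    unfold roundStep
    push_cast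
    rw [show ρ + (↑i + ↑n) * α = ρ + i * α + n * α by ring,
      show ρ + i * α + (n + 1) * α = ρ + i * α + n * α + α by ring]
    ring

/-- A balanced word of irrational slope is a coding of a rotation. -/
lemma exists_codesLetter {A : Type*} [DecidableEq A] {α : ℝ} {y : ℕ → A} {c : A}
    (h : ∀ i n : ℕ, ((factorAt y i n).count c : ℤ) = ⌊n * α⌋ ∨
      (n ≠ 0 ∧ ((factorAt y i n).count c : ℤ) = ⌊n * α⌋ + 1))
    (hα : Irrational α) : ∃ e ρ, CodesLetter α e ρ y c := by
  set N : ℕ → ℕ := fun n => (factorAt y 0 n).count c with hN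
  have hadd : ∀ i n, N (i + n) = N i + (factorAt y i n).count c := fun i n =>
    count_factorAt_add y i n c
  set g : ℕ → ℝ := fun n => N n - n * α with hg
  have hwin : ∀ i n, |((factorAt y i n).count c : ℝ) - n * α| < 1 := by
    intro i n
    have h1 := Int.floor_le (n * α)
    have h2 := Int.lt_floor_add_one (n * α)
    rw [abs_lt]
    rcases h i n with h | ⟨hn, h⟩
    · have : ((factorAt y i n).count c : ℝ) = ⌊n * α⌋ := by exact_mod_cast h
      constructor <;> linarith
    · have : ((factorAt y i n).count c : ℝ) = ⌊n * α⌋ + 1 := by exact_mod_cast h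
      have h3 : (⌊n * α⌋ : ℝ) ≠ n * α := ((hα.natCast_mul hn).ne_int _).symm
      have := h1.lt_of_ne h3
      constructor <;> linarith
  have hgap : ∀ i j, |g i - g j| < 1 := by
    have key : ∀ i n, |g (i + n) - g i| < 1 := by
      intro i n
      have : g (i + n) - g i = (factorAt y i n).count c - n * α := by
        simp only [hg, hadd]; push_cast; ring
      rw [this]; exact hwin i n
    intro i j
    rcases le_total i j with hij | hij <;> obtain ⟨k, rfl⟩ := Nat.exists_eq_add_of_le hij
    · rw [abs_sub_comm]; exact key _ _
    · exact key _ _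
  have hcount : ∀ e ρ, (∀ n, (N n : ℤ) = endRound e (ρ + n * α)) → CodesLetter α e ρ y c := by
    intro e ρ H i n
    have h1 := hadd i n
    have h2 := H (i + n)
    have h3 := H i
    unfold roundStep
    rw [show ρ + i * α + n * α = ρ + (i + n : ℕ) * α by push_cast; ring, ← h2, ← h3]
    omega
  have hbdd : BddAbove (Set.range g) := ⟨g 0 + 1, by
    rintro _ ⟨n, rfl⟩; linarith [(abs_lt.1 (hgap n 0)).2]⟩
  -- All values of `g` lie within distance less than 1 of each other. If all of them exceed sup - 1,
  -- the supremum is an intercept for the floor. Otherwise some `g k` is at most sup - 1; it is then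
  -- the minimum of `g`, and is an intercept for the ceiling.
  by_cases hc : ∀ n, sSup (Set.range g) - g n < 1
  · refine ⟨Endpoint.left, sSup (Set.range g), hcount _ _ fun n => ?_⟩
    symm
    change ⌊_⌋ = _
    rw [Int.floor_eq_iff]
    have h1 := le_csSup hbdd ⟨n, rfl⟩
    have h2 := hc n
    simp only [hg] at h1 h2 ⊢
    push_cast
    constructor <;> linarith
  · push Not at hc
    obtain ⟨k, hk⟩ := hc
    refine ⟨Endpoint.right, g k, hcount _ _ fun n => ?_⟩
    symm
    change ⌈_⌉ = _
    rw [Int.ceil_eq_iff]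
    have h1 : sSup (Set.range g) ≤ g n + 1 := csSup_le (Set.range_nonempty g) (by
      rintro _ ⟨j, rfl⟩; linarith [(abs_lt.1 (hgap j n)).2])
    have h2 := (abs_lt.1 (hgap n k)).2
    have h3 : g k ≤ g n := by linarith
    rw [show g n = N n - n * α from rfl] at h2 h3
    push_cast
    constructor <;> linarith

/-! ### Codings of pairs of arcs, heavy and light factors. -/

/-- The letters `1` and `2` of `y` code the rotation by `α` with intercepts `ρ` and `ρ - ξ`. -/
def CodesPair (α : ℝ) (a b : Endpoint) (ξ ρ : ℝ) (y : ℕ → Fin 3) : Prop :=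
  CodesLetter α a ρ y 1 ∧ CodesLetter α b (ρ - ξ) y 2

lemma lt_circleNorm_iff {α ξ : ℝ} (hα0 : 0 < α) (hα2 : α < 1 / 2) :
    circleNorm α < circleNorm ξ ↔ α < Int.fract ξ ∧ Int.fract ξ < 1 - α := by
  rw [circleNorm_of_mem hα0.le (by linarith), circleNorm, min_eq_left (by linarith), lt_min_iff]
  constructor <;> rintro ⟨h1, h2⟩ <;> constructor <;> linarith

/-- The bound on `circleNorm ξ` makes the two arcs disjoint, so the precedence of the letter 1 in
`ternaryCoding` hides no visit to the second arc. -/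
lemma codesPair_ternaryCoding {α : ℝ} (hα0 : 0 < α) (hα2 : α < 1 / 2) {ξ : ℝ} (h0 : 0 ≤ ξ)
    (h1 : ξ < 1) (hξ : circleNorm α < circleNorm ξ) (a b : Endpoint) (ρ : ℝ) :
    CodesPair α a b ξ ρ (ternaryCoding a b α ξ ρ) := by
  have hα1 : α < 1 := by linarith
  have hξ' := hξ
  rw [lt_circleNorm_iff hα0 hα2, Int.fract_eq_self.2 ⟨h0, h1⟩] at hξ
  rw [circleNorm_of_mem hα0.le hα1, min_eq_left (by linarith)] at hξ'
  have e1 : ∀ i : ℕ, Int.fract (ρ + i * α) ∈ arc a (1 - α) 1 ↔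
      roundStep a α (ρ + i * α) = 1 := fun i => by
    rw [mem_arc_iff a hα0 hα1, ← roundStep_add_int a α _ 1]; simp
  have e2 : ∀ i : ℕ, Int.fract (ρ + i * α) ∈ arc b (ξ - α) ξ ↔
      roundStep b α (ρ + i * α - ξ) = 1 := fun i => mem_arc_iff b hα0 hα1 _ _
  constructor <;> refine codesLetter_of_letter hα0 hα1 fun i => ?_
  · rw [← e1]
    unfold ternaryCoding
    split_ifs <;> simp_all
  · rw [show ρ - ξ + i * α = ρ + i * α - ξ by ring, ← e2]
    unfold ternaryCoding
    split_ifs with h2 h3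
    · refine ⟨fun h => absurd h (by decide), fun h3 => ?_⟩
      rw [e1] at h2
      rw [e2] at h3
      rcases roundStep_both_one hα0 hα1 h0 h1 h2 h3 with h | ⟨-, -, h, -⟩ | ⟨-, -, h, -⟩ <;> linarith
    · simp [h3]
    · simp [h3]

lemma CodesPair.eq_ternaryCoding {α : ℝ} (hα0 : 0 < α) (hα1 : α < 1) {ξ ρ : ℝ} {a b : Endpoint}
    {y : ℕ → Fin 3} (h : CodesPair α a b ξ ρ y) : y = ternaryCoding a b α ξ ρ := by
  funext i
  have e1 : Int.fract (ρ + i * α) ∈ arc a (1 - α) 1 ↔ y i = 1 := by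
    rw [mem_arc_iff a hα0 hα1, ← roundStep_add_int a α _ 1, h.1.letter]; simp
  have e2 : Int.fract (ρ + i * α) ∈ arc b (ξ - α) ξ ↔ y i = 2 := by
    rw [mem_arc_iff b hα0 hα1, h.2.letter, show ρ - ξ + i * α = ρ + i * α - ξ by ring]
  unfold ternaryCoding
  simp only [e1, e2]
  split_ifs with h1 h2
  · exact h1
  · exact h2
  · generalize y i = c at *
    fin_cases c <;> simp_all

/-- Some factor of `y` of length `n` has `⌊nα⌋ + 1` letters `1` and `⌊nα⌋ + 1` letters `2`. -/
def HasHeavyFactor (α : ℝ) (y : ℕ → Fin 3) (n : ℕ) : Prop :=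
  ∃ i, ((factorAt y i n).count 1 : ℤ) = 1 + ⌊n * α⌋ ∧ ((factorAt y i n).count 2 : ℤ) = 1 + ⌊n * α⌋

/-- Some factor of `y` of length `n` has `⌊nα⌋` letters `1` and `⌊nα⌋` letters `2`. -/
def HasLightFactor (α : ℝ) (y : ℕ → Fin 3) (n : ℕ) : Prop :=
  ∃ i, ((factorAt y i n).count 1 : ℤ) = 0 + ⌊n * α⌋ ∧ ((factorAt y i n).count 2 : ℤ) = 0 + ⌊n * α⌋

lemma fract_nat_mul_pos {α : ℝ} (hα : Irrational α) {n : ℕ} (hn : n ≠ 0) :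
    0 < Int.fract (n * α) := by
  refine (Int.fract_nonneg _).lt_of_ne fun h => (hα.natCast_mul hn).ne_int ⌊n * α⌋ ?_
  linarith [Int.fract_add_floor (n * α)]

lemma CodesPair.count_eq {α : ℝ} {a b : Endpoint} {ξ ρ : ℝ} {y : ℕ → Fin 3}
    (h : CodesPair α a b ξ ρ y) (i n : ℕ) :
    ((factorAt y i n).count 1 : ℤ) = roundStep a (Int.fract (n * α)) (ρ + i * α) + ⌊n * α⌋ ∧
      ((factorAt y i n).count 2 : ℤ) =
        roundStep b (Int.fract (n * α)) (ρ + i * α - ξ) + ⌊n * α⌋ :=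
  ⟨h.1.count_eq i n, by rw [h.2.count_eq i n, show ρ - ξ + i * α = ρ + i * α - ξ by ring]⟩

lemma CodesPair.hasHeavyFactor_iff {α : ℝ} {a b : Endpoint} {ξ ρ : ℝ} {y : ℕ → Fin 3}
    (h : CodesPair α a b ξ ρ y) (n : ℕ) :
    HasHeavyFactor α y n ↔ ∃ i : ℕ, roundStep a (Int.fract (n * α)) (ρ + i * α) = 1 ∧
      roundStep b (Int.fract (n * α)) (ρ + i * α - ξ) = 1 :=
  exists_congr fun i => by rw [(h.count_eq i n).1, (h.count_eq i n).2]; simp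

lemma CodesPair.hasLightFactor_iff {α : ℝ} {a b : Endpoint} {ξ ρ : ℝ} {y : ℕ → Fin 3}
    (h : CodesPair α a b ξ ρ y) (n : ℕ) :
    HasLightFactor α y n ↔ ∃ i : ℕ, roundStep a (Int.fract (n * α)) (ρ + i * α) = 0 ∧
      roundStep b (Int.fract (n * α)) (ρ + i * α - ξ) = 0 :=
  exists_congr fun i => by rw [(h.count_eq i n).1, (h.count_eq i n).2]; simp

lemma CodesPair.hasHeavyFactor {α : ℝ} (hα : Irrational α) {a b : Endpoint} {ξ ρ : ℝ}
    {y : ℕ → Fin 3} (h : CodesPair α a b ξ ρ y) (h0 : 0 ≤ ξ) (h1 : ξ < 1) {n : ℕ}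
    (hn : circleNorm ξ < Int.fract (n * α)) : HasHeavyFactor α y n :=
  (h.hasHeavyFactor_iff n).2
    (exists_roundStep_one_one hα a b ρ (Int.fract_lt_one _) h0 h1 hn)

lemma CodesPair.hasLightFactor {α : ℝ} (hα : Irrational α) {a b : Endpoint} {ξ ρ : ℝ}
    {y : ℕ → Fin 3} (h : CodesPair α a b ξ ρ y) (h0 : 0 ≤ ξ) (h1 : ξ < 1) {n : ℕ} (hn0 : n ≠ 0)
    (hn : circleNorm ξ < 1 - Int.fract (n * α)) : HasLightFactor α y n :=
  (h.hasLightFactor_iff n).2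
    (exists_roundStep_zero_zero hα a b ρ (fract_nat_mul_pos hα hn0) h0 h1 hn)

lemma CodesPair.count_cases {α : ℝ} (hα : Irrational α) {a b : Endpoint} {ξ ρ : ℝ}
    {y : ℕ → Fin 3} (h : CodesPair α a b ξ ρ y) (i : ℕ) {n : ℕ} (hn : n ≠ 0) :
    (((factorAt y i n).count 1 : ℤ) = 1 + ⌊n * α⌋ ∨ ((factorAt y i n).count 1 : ℤ) = 0 + ⌊n * α⌋) ∧
    (((factorAt y i n).count 2 : ℤ) = 1 + ⌊n * α⌋ ∨
      ((factorAt y i n).count 2 : ℤ) = 0 + ⌊n * α⌋) := by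
  rw [(h.count_eq i n).1, (h.count_eq i n).2]
  have h1 := fract_nat_mul_pos hα hn
  have h2 := Int.fract_lt_one ((n : ℝ) * α)
  constructor
  · exact (roundStep_eq_one_or_zero a _ h1 h2).imp (by intro h; rw [h]) (by intro h; rw [h])
  · exact (roundStep_eq_one_or_zero b _ h1 h2).imp (by intro h; rw [h]) (by intro h; rw [h])

/-- Among the codings of pairs of arcs, the abelian closure is decided by the lengths of the heavy
and the light factors. -/
lemma CodesPair.mem_abelianClosure_iff {α : ℝ} (hα : Irrational α) {a b a' b' : Endpoint}
    {ζ ρ ξ ρ' : ℝ} {u y : ℕ → Fin 3} (hu : CodesPair α a b ζ ρ u) (h0 : 0 < ζ) (h1 : ζ < 1)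
    (hy : CodesPair α a' b' ξ ρ' y) :
    y ∈ abelianClosure u ↔ ∀ n : ℕ, n ≠ 0 →
      (HasHeavyFactor α y n → HasHeavyFactor α u n) ∧
        (HasLightFactor α y n → HasLightFactor α u n) := by
  rw [_root_.mem_abelianClosure_iff]
  constructor
  · intro h n _
    constructor <;> rintro ⟨i, hi⟩ <;> obtain ⟨j, hj⟩ := h i n <;>
      exact ⟨j, by rw [← hj.1, ← hj.2]; exact hi⟩
  · intro h i n
    rcases eq_or_ne n 0 with rfl | hn
    · exact ⟨0, by simp [factorAt]⟩
    have d0 := fract_nat_mul_pos hα hn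
    have d1 := Int.fract_lt_one ((n : ℝ) * α)
    obtain ⟨c1, c2⟩ := hy.count_cases hα i hn
    suffices ∃ j : ℕ, ((factorAt y i n).count 1 : ℤ) = (factorAt u j n).count 1 ∧
        ((factorAt y i n).count 2 : ℤ) = (factorAt u j n).count 2 by exact_mod_cast this
    -- The two mixed patterns occur in `u` at every length n > 0; only the heavy and the light one
    -- use the hypothesis.
    rcases c1 with c1 | c1 <;> rcases c2 with c2 | c2 <;> rw [c1, c2]
    · obtain ⟨j, j1, j2⟩ := (h n hn).1 ⟨i, c1, c2⟩
      exact ⟨j, j1.symm, j2.symm⟩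
    · obtain ⟨j, j1, j2⟩ := exists_roundStep_one_zero hα a b ρ d0 d1 h0 h1
      exact ⟨j, by rw [(hu.count_eq j n).1, (hu.count_eq j n).2, j1, j2]; simp⟩
    · obtain ⟨j, j1, j2⟩ := exists_roundStep_zero_one hα a b ρ d0 d1 h0 h1
      exact ⟨j, by rw [(hu.count_eq j n).1, (hu.count_eq j n).2, j1, j2]; simp⟩
    · obtain ⟨j, j1, j2⟩ := (h n hn).2 ⟨i, c1, c2⟩
      exact ⟨j, j1.symm, j2.symm⟩

lemma circleNorm_le_half (x : ℝ) : circleNorm x ≤ 1 / 2 := by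
  rw [circleNorm]
  rcases le_total (Int.fract x) (1 / 2) with h | h
  · exact (min_le_left _ _).trans h
  · exact (min_le_right _ _).trans (by linarith)

lemma circleNorm_nonneg (x : ℝ) : 0 ≤ circleNorm x :=
  le_min (Int.fract_nonneg _) (by linarith [Int.fract_lt_one x])

lemma CodesLetter.congr_int {A : Type*} [DecidableEq A] {α : ℝ} {e : Endpoint} {ρ σ : ℝ}
    {y : ℕ → A} {c : A} (h : CodesLetter α e ρ y c) (k : ℤ) (hσ : σ = ρ + k) :
    CodesLetter α e σ y c := by
  intro i n
  rw [h i n, hσ, show ρ + k + i * α = ρ + i * α + k by ring, roundStep_add_int]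

/-- Every word in the abelian closure of a coding is a coding, with an offset at least as far from
`0`. -/
lemma CodesPair.exists_of_mem_abelianClosure {α : ℝ} (hα : Irrational α) {a b : Endpoint}
    {ζ ρ : ℝ} {u y : ℕ → Fin 3} (hu : CodesPair α a b ζ ρ u) (h0 : 0 ≤ ζ) (h1 : ζ < 1)
    (hy : y ∈ abelianClosure u) :
    ∃ a' b' : Endpoint, ∃ ξ ∈ Set.Ico (0 : ℝ) 1, ∃ ρ' ∈ Set.Ico (0 : ℝ) 1,
      circleNorm ζ ≤ circleNorm ξ ∧ CodesPair α a' b' ξ ρ' y := by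
  rw [_root_.mem_abelianClosure_iff] at hy
  have hbal : ∀ i n : ℕ, (((factorAt y i n).count 1 : ℤ) = ⌊n * α⌋ ∨
      (n ≠ 0 ∧ ((factorAt y i n).count 1 : ℤ) = ⌊n * α⌋ + 1)) ∧
      (((factorAt y i n).count 2 : ℤ) = ⌊n * α⌋ ∨
      (n ≠ 0 ∧ ((factorAt y i n).count 2 : ℤ) = ⌊n * α⌋ + 1)) := by
    intro i n
    rcases eq_or_ne n 0 with rfl | hn
    · simp [factorAt]
    obtain ⟨j, j1, j2⟩ := hy i n
    have := hu.count_cases hα j hn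
    rw [j1, j2]
    omega
  obtain ⟨a', ρ₁, ha⟩ := exists_codesLetter (fun i n => (hbal i n).1) hα
  obtain ⟨b', ρ₂, hb⟩ := exists_codesLetter (fun i n => (hbal i n).2) hα
  have hp : CodesPair α a' b' (Int.fract (ρ₁ - ρ₂)) (Int.fract ρ₁) y := by
    refine ⟨ha.congr_int (-⌊ρ₁⌋) ?_, hb.congr_int (⌊ρ₁ - ρ₂⌋ - ⌊ρ₁⌋) ?_⟩
    · push_cast; linarith [Int.fract_add_floor ρ₁]
    · push_cast; linarith [Int.fract_add_floor ρ₁, Int.fract_add_floor (ρ₁ - ρ₂)]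
  refine ⟨a', b', _, ⟨Int.fract_nonneg _, Int.fract_lt_one _⟩, _,
    ⟨Int.fract_nonneg _, Int.fract_lt_one _⟩, ?_, hp⟩
  by_contra hlt
  push Not at hlt
  -- If ‖ξ‖ < ‖ζ‖, a length n with ‖ξ‖ < {nα} < ‖ζ‖ gives a heavy factor of `y`, whereas `u` has
  -- none of that length.
  obtain ⟨n, n1, n2⟩ := exists_nat_fract_mem_Ioo hα 0 (circleNorm_nonneg _) hlt
    ((circleNorm_le_half _).trans (by norm_num))
  rw [zero_add] at n1 n2
  have hn : 0 < Int.fract (n * α) := (circleNorm_nonneg _).trans_lt n1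
  obtain ⟨i, i1, i2⟩ := hp.hasHeavyFactor hα (Int.fract_nonneg _) (Int.fract_lt_one _) n1
  obtain ⟨j, j1, j2⟩ := hy i n
  rw [j1] at i1
  rw [j2] at i2
  obtain ⟨k, k1, k2⟩ := (hu.hasHeavyFactor_iff n).1 ⟨j, i1, i2⟩
  rw [circleNorm_of_mem h0 h1, lt_min_iff] at n2
  rcases roundStep_both_one hn (Int.fract_lt_one _) h0 h1 k1 k2 with h | ⟨-, -, h, -⟩ | ⟨-, -, h, -⟩
  · rw [circleNorm_of_mem h0 h1, min_lt_iff] at h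
    rcases h with h | h <;> linarith
  · linarith
  · linarith

/-! ### The boundary case: exceptional words. -/

lemma fract_neg_nat_mul {α : ℝ} (hα : Irrational α) {n : ℕ} (hn : n ≠ 0) :
    Int.fract (-(n * α)) = 1 - Int.fract (n * α) :=
  Int.fract_neg (fract_nat_mul_pos hα hn).ne'

lemma eq_of_fract_nat_mul_eq {α : ℝ} (hα : Irrational α) {m n : ℕ}
    (h : Int.fract (m * α) = Int.fract (n * α)) : m = n := by
  obtain ⟨z, hz⟩ := Int.fract_eq_fract.1 h
  by_contra hmn
  refine (hα.intCast_mul (m := (m : ℤ) - n) (by omega)).ne_int z ?_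
  push_cast
  linarith

/-- Otherwise (m + n)α would be an integer. This keeps the heavy and the light boundary cases apart.
-/
lemma fract_nat_mul_add_ne_one {α : ℝ} (hα : Irrational α) {m n : ℕ} (hm : m ≠ 0) :
    Int.fract (m * α) + Int.fract (n * α) ≠ 1 := by
  intro h
  refine (hα.natCast_mul (m := m + n) (by omega)).ne_int (⌊m * α⌋ + ⌊n * α⌋ + 1) ?_
  push_cast
  linarith [Int.fract_add_floor (m * α), Int.fract_add_floor (n * α)]

lemma eq_fract_neg_of_fract_add_eq_zero {ρ t : ℝ} (h0 : 0 ≤ ρ) (h1 : ρ < 1)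
    (h : Int.fract (ρ + t) = 0) : ρ = Int.fract (-t) := by
  symm
  rw [Int.fract_eq_iff]
  exact ⟨h0, h1, -⌊ρ + t⌋, by push_cast; linarith [Int.fract_add_floor (ρ + t)]⟩

lemma eq_fract_neg_of_fract_add_eq {ρ s t : ℝ} (h0 : 0 ≤ ρ) (h1 : ρ < 1)
    (h : Int.fract (ρ + t) = Int.fract (-s)) : ρ = Int.fract (-(s + t)) := by
  apply eq_fract_neg_of_fract_add_eq_zero h0 h1
  rw [show ρ + (s + t) = ρ + t + s by ring, Int.fract_eq_iff]
  exact ⟨le_rfl, one_pos, ⌊ρ + t⌋ - ⌊-s⌋, by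
    push_cast; linarith [Int.fract_add_floor (ρ + t), Int.fract_add_floor (-s)]⟩

lemma fract_fract_neg_add (t : ℝ) : Int.fract (Int.fract (-t) + t) = 0 := by
  rw [Int.fract_eq_iff]
  exact ⟨le_rfl, one_pos, -⌊-t⌋, by push_cast; linarith [Int.fract_add_floor (-t)]⟩

lemma fract_fract_neg_add_add (s t : ℝ) :
    Int.fract (Int.fract (-(s + t)) + t) = Int.fract (-s) := by
  rw [Int.fract_eq_fract]
  exact ⟨-⌊-(s + t)⌋, by push_cast; linarith [Int.fract_add_floor (-(s + t))]⟩

/-- Arcs of length {nα} ≤ ‖ξ‖ have disjoint interiors, so a heavy factor at position i starts at a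
common endpoint of both. This fixes the conventions and ξ, and the intercept is found by rotating
back i steps: i is the index in the family of exceptions. -/
lemma CodesPair.mem_heavyExceptions {α : ℝ} (hα : Irrational α) (hα0 : 0 < α) (hα1 : α < 1)
    {a b : Endpoint} {ξ ρ : ℝ} {y : ℕ → Fin 3} (h : CodesPair α a b ξ ρ y) (h0 : 0 ≤ ξ)
    (h1 : ξ < 1) (hρ0 : 0 ≤ ρ) (hρ1 : ρ < 1) {n : ℕ} (hn : n ≠ 0) (hy : HasHeavyFactor α y n)
    (hle : Int.fract (n * α) ≤ circleNorm ξ) :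
    circleNorm ξ = Int.fract (n * α) ∧ y ∈ heavyExceptions α n := by
  obtain ⟨i, i1, i2⟩ := (h.hasHeavyFactor_iff n).1 hy
  have hneg := fract_neg_nat_mul hα hn
  have hy := h.eq_ternaryCoding hα0 hα1
  rw [circleNorm_of_mem h0 h1] at hle ⊢
  rcases roundStep_both_one (fract_nat_mul_pos hα hn) (Int.fract_lt_one _) h0 h1 i1 i2 with
    h' | ⟨rfl, rfl, h', hx⟩ | ⟨rfl, rfl, h', hx⟩
  · rw [circleNorm_of_mem h0 h1] at h'
    linarith
  · exact ⟨le_antisymm (h' ▸ min_le_left _ _) hle, Or.inl ⟨i, by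
      rw [hy, h', ← eq_fract_neg_of_fract_add_eq_zero hρ0 hρ1 hx]⟩⟩
  · refine ⟨le_antisymm ((min_le_right _ _).trans (by linarith)) hle, Or.inr ⟨i, ?_⟩⟩
    rw [← hneg] at hx h'
    rw [hy, h', add_mul, ← eq_fract_neg_of_fract_add_eq hρ0 hρ1 hx]

/-- Same argument for the complementary arcs, of length 1 - {nα}; complementation swaps the endpoint
conventions. -/
lemma CodesPair.mem_lightExceptions {α : ℝ} (hα : Irrational α) (hα0 : 0 < α) (hα1 : α < 1)
    {a b : Endpoint} {ξ ρ : ℝ} {y : ℕ → Fin 3} (h : CodesPair α a b ξ ρ y) (h0 : 0 ≤ ξ)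
    (h1 : ξ < 1) (hρ0 : 0 ≤ ρ) (hρ1 : ρ < 1) {n : ℕ} (hn : n ≠ 0) (hy : HasLightFactor α y n)
    (hle : 1 - Int.fract (n * α) ≤ circleNorm ξ) :
    circleNorm ξ = 1 - Int.fract (n * α) ∧ y ∈ lightExceptions α n := by
  obtain ⟨i, i1, i2⟩ := (h.hasLightFactor_iff n).1 hy
  have hneg := fract_neg_nat_mul hα hn
  have hy := h.eq_ternaryCoding hα0 hα1
  rw [circleNorm_of_mem h0 h1] at hle ⊢
  rcases roundStep_both_zero (fract_nat_mul_pos hα hn) (Int.fract_lt_one _) h0 h1 i1 i2 with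
    h' | ⟨rfl, rfl, h', hx⟩ | ⟨rfl, rfl, h', hx⟩
  · rw [circleNorm_of_mem h0 h1] at h'
    linarith
  · refine ⟨le_antisymm ((min_le_left _ _).trans (by linarith)) hle, Or.inl ⟨i, ?_⟩⟩
    rw [← hneg] at hx h'
    rw [hy, h', add_mul, ← eq_fract_neg_of_fract_add_eq hρ0 hρ1 hx]
  · exact ⟨le_antisymm ((min_le_right _ _).trans (by linarith)) hle, Or.inr ⟨i, by
      rw [hy, h', ← eq_fract_neg_of_fract_add_eq_zero hρ0 hρ1 hx]⟩⟩

lemma roundStep_of_fract_eq_zero {δ x : ℝ} (hδ0 : 0 < δ) (hδ1 : δ < 1) (h : Int.fract x = 0) :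
    roundStep Endpoint.right δ x = 1 ∧ roundStep Endpoint.left δ x = 0 := by
  rw [← roundStep_fract _ _ x, ← roundStep_fract Endpoint.left _ x, h]
  have hl := roundStep_eq_of_fract (e := Endpoint.left) hδ0 hδ1 le_rfl one_pos
  have hr := roundStep_eq_of_fract (e := Endpoint.right) hδ0 hδ1 le_rfl one_pos
  constructor
  · refine (hr.resolve_right ?_).1
    rintro ⟨-, h | h | h⟩
    · exact lt_irrefl _ h.1
    · linarith [h.2]
    · exact absurd h.1 (by simp)
  · refine (hl.resolve_left ?_).1
    rintro ⟨-, h | h | h⟩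
    · linarith
    · linarith [h.2]
    · exact absurd h.1 (by simp)

lemma roundStep_of_fract_eq {δ x : ℝ} (hδ0 : 0 < δ) (hδ1 : δ < 1) (h : Int.fract x = 1 - δ) :
    roundStep Endpoint.left δ x = 1 ∧ roundStep Endpoint.right δ x = 0 := by
  rw [← roundStep_fract _ _ x, ← roundStep_fract Endpoint.right _ x, h]
  have hl := roundStep_eq_of_fract (e := Endpoint.left) (r := 1 - δ) hδ0 hδ1 (by linarith)
    (by linarith)
  have hr := roundStep_eq_of_fract (e := Endpoint.right) (r := 1 - δ) hδ0 hδ1 (by linarith)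
    (by linarith)
  constructor
  · refine (hl.resolve_right ?_).1
    rintro ⟨-, h | h | h⟩
    · exact lt_irrefl _ h.2
    · exact absurd h.1 (by simp)
    · linarith [h.2]
  · refine (hr.resolve_left ?_).1
    rintro ⟨-, h | h | h⟩
    · exact lt_irrefl _ h
    · exact absurd h.1 (by simp)
    · linarith [h.2]

/-- Converse of `CodesPair.mem_heavyExceptions`: after i steps the orbit is at the common endpoint.
The number `c` only ensures that {nα} is at most 1/2 and larger than ‖α‖, so that the exceptions
really are codings of disjoint arcs. -/
lemma hasHeavyFactor_of_mem_heavyExceptions {α : ℝ} (hα : Irrational α) (hα0 : 0 < α)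
    (hα2 : α < 1 / 2) {n : ℕ} (hn : n ≠ 0) {c : ℝ} (hc : circleNorm α < circleNorm c)
    (hnc : circleNorm c = Int.fract (n * α)) {y : ℕ → Fin 3} (hy : y ∈ heavyExceptions α n) :
    HasHeavyFactor α y n := by
  have hneg := fract_neg_nat_mul hα hn
  have d0 := fract_nat_mul_pos hα hn
  have d1 := Int.fract_lt_one ((n : ℝ) * α)
  have d2 := circleNorm_le_half c
  rcases hy with ⟨i, rfl⟩ | ⟨i, rfl⟩
  · have hp := codesPair_ternaryCoding (ξ := Int.fract (n * α)) hα0 hα2 d0.le d1 (by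
      rw [circleNorm_of_mem d0.le d1, min_eq_left (by linarith), ← hnc]; exact hc)
      Endpoint.right Endpoint.left (Int.fract (-(i * α)))
    have hx := fract_fract_neg_add (i * α)
    refine (hp.hasHeavyFactor_iff n).2 ⟨i, (roundStep_of_fract_eq_zero d0 d1 hx).1,
      (roundStep_of_fract_eq d0 d1 ?_).1⟩
    rcases fract_sub_eq (x := Int.fract (-(i * α)) + i * α) d0.le d1 with h | h <;> linarith
  · have hp := codesPair_ternaryCoding (ξ := Int.fract (-(n * α))) hα0 hα2 (Int.fract_nonneg _)
      (Int.fract_lt_one _) (by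
        rw [hneg, circleNorm_of_mem (ξ := 1 - Int.fract (n * α)) (by linarith) (by linarith),
          min_eq_right (by linarith),
          sub_sub_cancel, ← hnc]
        exact hc) Endpoint.left Endpoint.right (Int.fract (-((n + i) * α)))
    have hx := fract_fract_neg_add_add (n * α) (i * α)
    rw [← add_mul, hneg] at hx
    refine (hp.hasHeavyFactor_iff n).2 ⟨i, (roundStep_of_fract_eq d0 d1 hx).1,
      (roundStep_of_fract_eq_zero d0 d1 ?_).1⟩
    rcases fract_sub_eq (x := Int.fract (-((n + i) * α)) + i * α)
      (Int.fract_nonneg (-(n * α))) (Int.fract_lt_one (-(n * α))) with h | h <;> linarith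

lemma hasLightFactor_of_mem_lightExceptions {α : ℝ} (hα : Irrational α) (hα0 : 0 < α)
    (hα2 : α < 1 / 2) {n : ℕ} (hn : n ≠ 0) {c : ℝ} (hc : circleNorm α < circleNorm c)
    (hnc : circleNorm c = 1 - Int.fract (n * α)) {y : ℕ → Fin 3} (hy : y ∈ lightExceptions α n) :
    HasLightFactor α y n := by
  have hneg := fract_neg_nat_mul hα hn
  have d0 := fract_nat_mul_pos hα hn
  have d1 := Int.fract_lt_one ((n : ℝ) * α)
  have d2 := circleNorm_le_half c
  rcases hy with ⟨i, rfl⟩ | ⟨i, rfl⟩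
  · have hp := codesPair_ternaryCoding (ξ := Int.fract (-(n * α))) hα0 hα2 (Int.fract_nonneg _)
      (Int.fract_lt_one _) (by
        rw [hneg, circleNorm_of_mem (ξ := 1 - Int.fract (n * α)) (by linarith) (by linarith),
          min_eq_left (by linarith), ← hnc]
        exact hc) Endpoint.right Endpoint.left (Int.fract (-((n + i) * α)))
    have hx := fract_fract_neg_add_add (n * α) (i * α)
    rw [← add_mul, hneg] at hx
    refine (hp.hasLightFactor_iff n).2 ⟨i, (roundStep_of_fract_eq d0 d1 hx).2,
      (roundStep_of_fract_eq_zero d0 d1 ?_).2⟩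
    rcases fract_sub_eq (x := Int.fract (-((n + i) * α)) + i * α)
      (Int.fract_nonneg (-(n * α))) (Int.fract_lt_one (-(n * α))) with h | h <;> linarith
  · have hp := codesPair_ternaryCoding (ξ := Int.fract (n * α)) hα0 hα2 d0.le d1 (by
      rw [circleNorm_of_mem d0.le d1, min_eq_right (by linarith), ← hnc]; exact hc)
      Endpoint.left Endpoint.right (Int.fract (-(i * α)))
    have hx := fract_fract_neg_add (i * α)
    refine (hp.hasLightFactor_iff n).2 ⟨i, (roundStep_of_fract_eq_zero d0 d1 hx).2,
      (roundStep_of_fract_eq d0 d1 ?_).2⟩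
    rcases fract_sub_eq (x := Int.fract (-(i * α)) + i * α) d0.le d1 with h | h <;> linarith

lemma countable_heavyExceptions (α : ℝ) (m : ℕ) : (heavyExceptions α m).Countable := by
  refine Set.Countable.union ?_ ?_
  · refine (Set.countable_range fun n : ℕ => ternaryCoding Endpoint.right Endpoint.left α
      (Int.fract (m * α)) (Int.fract (-(n * α)))).mono ?_
    rintro _ ⟨n, rfl⟩
    exact ⟨n, rfl⟩
  · refine (Set.countable_range fun n : ℕ => ternaryCoding Endpoint.left Endpoint.right α
      (Int.fract (-(m * α))) (Int.fract (-((m + n) * α)))).mono ?_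
    rintro _ ⟨n, rfl⟩
    exact ⟨n, rfl⟩

lemma countable_lightExceptions (α : ℝ) (m : ℕ) : (lightExceptions α m).Countable := by
  refine Set.Countable.union ?_ ?_
  · refine (Set.countable_range fun n : ℕ => ternaryCoding Endpoint.right Endpoint.left α
      (Int.fract (-(m * α))) (Int.fract (-((m + n) * α)))).mono ?_
    rintro _ ⟨n, rfl⟩
    exact ⟨n, rfl⟩
  · refine (Set.countable_range fun n : ℕ => ternaryCoding Endpoint.left Endpoint.right α
      (Int.fract (m * α)) (Int.fract (-(n * α)))).mono ?_
    rintro _ ⟨n, rfl⟩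
    exact ⟨n, rfl⟩

/-- The words which have to be removed: the heavy exceptions of the length `n` with
`{nα} = circleNorm ζ`, and the light exceptions of the length `n` with `{-nα} = circleNorm ζ`,
unless `u` is one of them. -/
def exceptionalWords (α ζ : ℝ) (u : ℕ → Fin 3) : Set (ℕ → Fin 3) :=
  {w | ∃ n : ℕ, n ≠ 0 ∧
    ((circleNorm ζ = Int.fract (n * α) ∧ u ∉ heavyExceptions α n ∧ w ∈ heavyExceptions α n) ∨
      (circleNorm ζ = 1 - Int.fract (n * α) ∧ u ∉ lightExceptions α n ∧
        w ∈ lightExceptions α n))}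

lemma countable_exceptionalWords (α ζ : ℝ) (u : ℕ → Fin 3) :
    (exceptionalWords α ζ u).Countable := by
  refine (Set.countable_iUnion fun n =>
    (countable_heavyExceptions α n).union (countable_lightExceptions α n)).mono ?_
  rintro w ⟨n, -, h⟩
  rw [Set.mem_iUnion]
  exact ⟨n, h.imp (fun h => h.2.2) (fun h => h.2.2)⟩

/-- If `y` has a heavy factor of length n and `u` has none, then {nα} ≤ ‖ζ‖ ≤ ‖ξ‖, while a heavy
factor of `y` excludes {nα} < ‖ξ‖. So all three are equal and `y` is a heavy exception; light
factors behave alike. -/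
lemma CodesPair.mem_abelianClosure_iff_notMem_exceptionalWords {α : ℝ} (hα : Irrational α)
    (hα0 : 0 < α) (hα2 : α < 1 / 2) {a b a' b' : Endpoint} {ζ ρ ξ ρ' : ℝ} {u y : ℕ → Fin 3}
    (hu : CodesPair α a b ζ ρ u) (hζ : ζ ∈ Set.Ico (0 : ℝ) 1) (hρ : ρ ∈ Set.Ico (0 : ℝ) 1)
    (hζα : circleNorm α < circleNorm ζ) (hy : CodesPair α a' b' ξ ρ' y)
    (hξ : ξ ∈ Set.Ico (0 : ℝ) 1) (hρ' : ρ' ∈ Set.Ico (0 : ℝ) 1)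
    (hle : circleNorm ζ ≤ circleNorm ξ) :
    y ∈ abelianClosure u ↔ y ∉ exceptionalWords α ζ u := by
  have hα1 : α < 1 := by linarith
  have hζ0 : 0 < ζ := by
    have := (circleNorm_nonneg α).trans_lt hζα
    rw [circleNorm_of_mem hζ.1 hζ.2, lt_min_iff] at this
    exact this.1
  rw [hu.mem_abelianClosure_iff hα hζ0 hζ.2 hy]
  constructor
  · rintro h ⟨n, hn, ⟨h1, h2, h3⟩ | ⟨h1, h2, h3⟩⟩
    · have h4 := (h n hn).1 (hasHeavyFactor_of_mem_heavyExceptions hα hα0 hα2 hn hζα h1 h3)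
      exact h2 (hu.mem_heavyExceptions hα hα0 hα1 hζ.1 hζ.2 hρ.1 hρ.2 hn h4 h1.ge).2
    · have h4 := (h n hn).2 (hasLightFactor_of_mem_lightExceptions hα hα0 hα2 hn hζα h1 h3)
      exact h2 (hu.mem_lightExceptions hα hα0 hα1 hζ.1 hζ.2 hρ.1 hρ.2 hn h4 h1.ge).2
  · intro h n hn
    constructor <;> intro hyn <;> by_contra hun
    · have h1 : Int.fract (n * α) ≤ circleNorm ζ :=
        le_of_not_gt fun h1 => hun (hu.hasHeavyFactor hα hζ.1 hζ.2 h1)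
      obtain ⟨h2, h3⟩ := hy.mem_heavyExceptions hα hα0 hα1 hξ.1 hξ.2 hρ'.1 hρ'.2 hn hyn
        (h1.trans hle)
      have h4 : circleNorm ζ = Int.fract (n * α) := le_antisymm (hle.trans h2.le) h1
      exact h ⟨n, hn, Or.inl ⟨h4, fun h5 =>
        hun (hasHeavyFactor_of_mem_heavyExceptions hα hα0 hα2 hn hζα h4 h5), h3⟩⟩
    · have h1 : 1 - Int.fract (n * α) ≤ circleNorm ζ :=
        le_of_not_gt fun h1 => hun (hu.hasLightFactor hα hζ.1 hζ.2 hn h1)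
      obtain ⟨h2, h3⟩ := hy.mem_lightExceptions hα hα0 hα1 hξ.1 hξ.2 hρ'.1 hρ'.2 hn hyn
        (h1.trans hle)
      have h4 : circleNorm ζ = 1 - Int.fract (n * α) := le_antisymm (hle.trans h2.le) h1
      exact h ⟨n, hn, Or.inr ⟨h4, fun h5 =>
        hun (hasLightFactor_of_mem_lightExceptions hα hα0 hα2 hn hζα h4 h5), h3⟩⟩

/-- By irrationality at most one n can satisfy either boundary equation. -/
lemma exceptionalWords_eq_of_heavy {α : ℝ} (hα : Irrational α) {ζ : ℝ} (u : ℕ → Fin 3) {m : ℕ}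
    (hm : m ≠ 0) (h : circleNorm ζ = Int.fract (m * α)) :
    exceptionalWords α ζ u = {w | u ∉ heavyExceptions α m ∧ w ∈ heavyExceptions α m} := by
  ext w
  constructor
  · rintro ⟨n, hn, ⟨h1, h2⟩ | ⟨h1, -⟩⟩
    · obtain rfl := eq_of_fract_nat_mul_eq hα (h.symm.trans h1)
      exact h2
    · exact absurd (by linarith) (fract_nat_mul_add_ne_one hα hm (n := n))
  · exact fun h1 => ⟨m, hm, Or.inl ⟨h, h1⟩⟩

lemma exceptionalWords_eq_of_light {α : ℝ} (hα : Irrational α) {ζ : ℝ} (u : ℕ → Fin 3) {m : ℕ}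
    (hm : m ≠ 0) (h : circleNorm ζ = 1 - Int.fract (m * α)) :
    exceptionalWords α ζ u = {w | u ∉ lightExceptions α m ∧ w ∈ lightExceptions α m} := by
  ext w
  constructor
  · rintro ⟨n, hn, ⟨h1, -⟩ | ⟨h1, h2⟩⟩
    · exact absurd (by linarith) (fract_nat_mul_add_ne_one hα hm (n := n))
    · obtain rfl := eq_of_fract_nat_mul_eq hα (m := m) (n := n) (by linarith)
      exact h2
  · exact fun h1 => ⟨m, hm, Or.inr ⟨h, h1⟩⟩

theorem mainTheorem8 (α : ℝ) (hα : Irrational α) (hα0 : 0 < α) (hα2 : α < 1 / 2)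
    (ζ : ℝ) (hζ : ζ ∈ Set.Ico (0 : ℝ) 1) (hζα : circleNorm α < circleNorm ζ)
    (ρ : ℝ) (hρ : ρ ∈ Set.Ico (0 : ℝ) 1) (a b : Endpoint)
    (u : ℕ → Fin 3) (hu : u = ternaryCoding a b α ζ ρ) :
    ∃ S : Set (ℕ → Fin 3),
      S.Countable ∧
      abelianClosure u =
        {w | ∃ (a' b' : Endpoint), ∃ ξ ∈ Set.Ico (0 : ℝ) 1, ∃ ρ' ∈ Set.Ico (0 : ℝ) 1,
          circleNorm ζ ≤ circleNorm ξ ∧ w ∈ orbitClosure (ternaryCoding a' b' α ξ ρ')} \ S ∧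
      ((∀ m : ℕ, 1 - circleNorm ζ ≠ Int.fract (-(m * α)) ∧
          circleNorm ζ ≠ Int.fract (-(m * α))) → S = ∅) ∧
      (∀ m : ℕ, 1 ≤ m → 1 - circleNorm ζ = Int.fract (-(m * α)) →
        (u ∈ heavyExceptions α m → S = ∅) ∧
        (u ∉ heavyExceptions α m → S = heavyExceptions α m)) ∧
      (∀ m : ℕ, 1 ≤ m → circleNorm ζ = Int.fract (-(m * α)) →
        (u ∈ lightExceptions α m → S = ∅) ∧
        (u ∉ lightExceptions α m → S = lightExceptions α m)) := by
  have hα1 : α < 1 := by linarith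
  have hp : CodesPair α a b ζ ρ u := hu ▸ codesPair_ternaryCoding hα0 hα2 hζ.1 hζ.2 hζα a b ρ
  refine ⟨exceptionalWords α ζ u, countable_exceptionalWords α ζ u, ?_, ?_, ?_, ?_⟩
  · ext w
    constructor
    · intro hw
      obtain ⟨a', b', ξ, hξ, ρ', hρ', hle, hc⟩ :=
        hp.exists_of_mem_abelianClosure hα hζ.1 hζ.2 hw
      refine ⟨⟨a', b', ξ, hξ, ρ', hρ', hle, ?_⟩, ?_⟩
      · rw [← hc.eq_ternaryCoding hα0 hα1]
        exact Set.Subset.refl (language w)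
      · exact (hp.mem_abelianClosure_iff_notMem_exceptionalWords hα hα0 hα2 hζ hρ hζα hc hξ hρ'
          hle).1 hw
    -- A word in an orbit closure need not be the given coding, but it lies in the abelian closure
    -- of that coding. Hence it is itself a coding, possibly with other conventions and offset, and
    -- the criterion applies to it.
    · rintro ⟨⟨a₁, b₁, ξ₁, hξ₁, ρ₁, hρ₁, hle₁, hw⟩, hwS⟩
      obtain ⟨a', b', ξ, hξ, ρ', hρ', hle, hc⟩ :=
        (codesPair_ternaryCoding hα0 hα2 hξ₁.1 hξ₁.2 (hζα.trans_le hle₁) a₁ b₁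
          ρ₁).exists_of_mem_abelianClosure hα hξ₁.1 hξ₁.2 (orbitClosure_subset_abelianClosure _ hw)
      exact (hp.mem_abelianClosure_iff_notMem_exceptionalWords hα hα0 hα2 hζ hρ hζα hc hξ hρ'
        (hle₁.trans hle)).2 hwS
  · intro h
    refine Set.eq_empty_of_forall_notMem ?_
    rintro w ⟨n, hn, h1 | h1⟩
    · exact (h n).1 (by rw [fract_neg_nat_mul hα hn, h1.1])
    · exact (h n).2 (by rw [fract_neg_nat_mul hα hn, h1.1])
  · intro m hm h
    -- For m ≥ 1 the assumption becomes ‖ζ‖ = {mα}, the heavy boundary equation.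
    rw [fract_neg_nat_mul hα (by omega)] at h
    rw [exceptionalWords_eq_of_heavy hα u (m := m) (by omega) (by linarith)]
    exact ⟨fun h1 => by simp [h1], fun h1 => by simp [h1]⟩
  · intro m hm h
    rw [fract_neg_nat_mul hα (by omega)] at h
    rw [exceptionalWords_eq_of_light hα u (m := m) (by omega) h]
    exact ⟨fun h1 => by simp [h1], fun h1 => by simp [h1]⟩
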